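/- Fix a type of algebras: a set of operation symbols, each with an arity that is a (possibly infinite, possibly empty) set. The empty algebra is admitted if there are no zeroary operations. A \emph{prevariety} is a class $\mathbf P$ of algebras of this type that contains every algebra isomorphic to a subalgebra of a member of $\mathbf P$ and every algebra isomorphic to a direct product of a set-indexed family of members of $\mathbf P$ (including the empty family, whose product is the one-element algebra). If all arities are finite, a prevariety is called a \emph{quasivariety} if it can be defined by sentences of the form $$\forall x_1,\dots,x_n\ \Big(\bigwedge_{j=1}^m a_j(x)=b_j(x)\Big)\implies c(x)=d(x)$$ with $n,m\ge 0$ finite and $a_j,b_j,c,d$ terms. The prevariety (respectively, the quasivariety) generated by a class $\mathbf X$ of algebras is the least prevariety (respectively, quasivariety) containing $\mathbf X$. An algebra is \emph{trivial} if it has exactly one element (so the empty algebra is nontrivial). A set $\mathbf X$ of algebras in $\mathbf P$ is \emph{$\mathbf P$-compatible} if there is an algebra $B$ in $\mathbf P$ admitting one-to-one homomorphisms $A\to B$ for all $A\in\mathbf X$ (equivalently, all coprojections $A_0\to\coprod_{\mathbf P}^{A\in\mathbf X}A$, $A_0\in\mathbf X$, are one-to-one). Write $A\preceq B$ if $A$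 is embeddable in $B$. A class $\mathbf K$ of algebras is \emph{absolutely directed} under $\preceq$ if for every set $\mathbf Y\subseteq\mathbf K$ (including $\mathbf Y=\emptyset$) there is $B\in\mathbf K$ with $A\preceq B$ for all $A\in\mathbf Y$. **Theorem.** Let $\mathbf P$ be a prevariety. Then the following conditions are equivalent. 1. Every set of nontrivial algebras in $\mathbf P$ is $\mathbf P$-compatible. 2. $\mathbf P$ is generated as a prevariety by a class of algebras absolutely directed under $\preceq$. Moreover, if $\mathbf P$ is a quasivariety (so that all operations have finite arity), then the above conditions are also equivalent to each of the following. 3. Every pair of nontrivial algebras in $\mathbf P$ is $\mathbf P$-compatible. 4. $\mathbf P$ is generated as a quasivariety by a class of algebras absolutely directed under $\preceq$. 5. $\mathbf P$ is generated as a quasivariety by a single algebra. -/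

import Mathlib

universe u

namespace UnivAlg

/-- A type of algebras: a set of operation symbols, each with an arity that is an arbitrary
(possibly infinite, possibly empty) set.  Here and below "set" means `u`-small, and "class"
means a class of structures with carriers in `Type u`. -/
structure Signature : Type (u + 1) where
  Op : Type u
  arity : Op → Type u

/-- An algebra of type `S`.  The carrier may be empty if there are no zeroary operations. -/
structure Alg (S : Signature.{u}) : Type (u + 1) where
  carrier : Type u
  op : (o : S.Op) → (S.arity o → carrier) → carrier

variable {S : Signature.{u}}

/-- Homomorphisms of algebras. -/
def IsHom (A B : Alg S) (f : A.carrier → B.carrier) : Prop :=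
  ∀ (o : S.Op) (a : S.arity o → A.carrier), f (A.op o a) = B.op o (fun i => f (a i))

/-- `A` is embeddable in `B`: there is a one-to-one homomorphism `A → B`; equivalently, `A` is
isomorphic to a subalgebra of `B`. -/
def Embeds (A B : Alg S) : Prop :=
  ∃ f : A.carrier → B.carrier, IsHom A B f ∧ Function.Injective f

/-- `A` and `B` are isomorphic. -/
def IsIso (A B : Alg S) : Prop :=
  ∃ f : A.carrier → B.carrier, IsHom A B f ∧ Function.Bijective f

/-- The direct product of a family of algebras, as an algebra of tuples. -/
def prod {ι : Type u} (F : ι → Alg S) : Alg S where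
  carrier := (i : ι) → (F i).carrier
  op o a := fun i => (F i).op o (fun k => a k i)

/-- The class of algebras isomorphic to subalgebras of members of `X`. -/
def classS (X : Set (Alg S)) : Set (Alg S) :=
  {A | ∃ B ∈ X, Embeds A B}

/-- The class of algebras isomorphic to direct products of set-indexed (possibly empty) families
of members of `X`. -/
def classPr (X : Set (Alg S)) : Set (Alg S) :=
  {A | ∃ (ι : Type u) (F : ι → Alg S), (∀ i, F i ∈ X) ∧ IsIso A (prod F)}

/-- A prevariety: a class of algebras closed under subalgebras and direct products
(up to isomorphism). -/
def IsPrevariety (P : Set (Alg S)) : Prop :=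
  classS P ⊆ P ∧ classPr P ⊆ P

/-- Terms in the operations of `S` and the variables `V`. -/
inductive Term (S : Signature.{u}) (V : Type) : Type u
  | var (v : V) : Term S V
  | app (o : S.Op) (t : S.arity o → Term S V) : Term S V

/-- The value of a term in an algebra under an assignment of the variables. -/
def Term.eval {V : Type} (A : Alg S) (x : V → A.carrier) : Term S V → A.carrier
  | .var v => x v
  | .app o t => A.op o (fun i => (t i).eval A x)

/-- A finite Horn sentence `∀ x₁ … xₙ, (⋀ⱼ aⱼ(x) = bⱼ(x)) → c(x) = d(x)`, with finitely many
variables and finitely many (possibly no) premises. -/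
structure QuasiIdentity (S : Signature.{u}) : Type u where
  numVars : ℕ
  premises : List (Term S (Fin numVars) × Term S (Fin numVars))
  conclusion : Term S (Fin numVars) × Term S (Fin numVars)

/-- The algebra `A` satisfies the finite Horn sentence `q`. -/
def QuasiIdentity.Holds (q : QuasiIdentity S) (A : Alg S) : Prop :=
  ∀ x : Fin q.numVars → A.carrier,
    (∀ e ∈ q.premises, e.1.eval A x = e.2.eval A x) →
      q.conclusion.1.eval A x = q.conclusion.2.eval A x

/-- A quasivariety: a prevariety of finitary algebras that can be defined by finite Horn
sentences. -/
structure IsQuasivariety (P : Set (Alg S)) : Prop where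
  finitary : ∀ o : S.Op, Finite (S.arity o)
  prevariety : IsPrevariety P
  definable : ∃ Φ : Set (QuasiIdentity S), P = {A | ∀ q ∈ Φ, q.Holds A}

/-- `P` is the prevariety generated by `X`, i.e. the least prevariety containing `X`. -/
def IsPrevarietyGeneratedBy (P X : Set (Alg S)) : Prop :=
  IsLeast {Q : Set (Alg S) | IsPrevariety Q ∧ X ⊆ Q} P

/-- `P` is the quasivariety generated by `X`, i.e. the least quasivariety containing `X`. -/
def IsQuasivarietyGeneratedBy (P X : Set (Alg S)) : Prop :=
  IsLeast {Q : Set (Alg S) | IsQuasivariety Q ∧ X ⊆ Q} P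

/-- Trivial algebras are the one-element algebras (so the empty algebra is not trivial). -/
def IsTrivial (A : Alg S) : Prop :=
  ∃ x : A.carrier, ∀ y : A.carrier, y = x

/-- A set `X` of algebras is `P`-compatible if some algebra in `P` admits one-to-one
homomorphisms from all members of `X`; see `isCompatible_range_iff_of_isCoproduct` for the
formulation through coproducts in `P`. -/
def IsCompatible (P X : Set (Alg S)) : Prop :=
  ∃ B ∈ P, ∀ A ∈ X, Embeds A B

/-- `C` with the maps `c i` is a coproduct of the family `F` in the class `P`. -/
def IsCoproduct (P : Set (Alg S)) {ι : Type u} (F : ι → Alg S) (C : Alg S)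
    (c : (i : ι) → (F i).carrier → C.carrier) : Prop :=
  C ∈ P ∧ (∀ i, IsHom (F i) C (c i)) ∧
    ∀ B ∈ P, ∀ g : (i : ι) → (F i).carrier → B.carrier, (∀ i, IsHom (F i) B (g i)) →
      ∃! h : C.carrier → B.carrier, IsHom C B h ∧ ∀ i x, h (c i x) = g i x

theorem isCompatible_range_iff_of_isCoproduct {P : Set (Alg S)} {ι : Type u} {F : ι → Alg S}
    {C : Alg S} {c : (i : ι) → (F i).carrier → C.carrier} (hC : IsCoproduct P F C c) :
    IsCompatible P (Set.range F) ↔ ∀ i, Function.Injective (c i) := by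
  constructor
  · rintro ⟨B, hB, h⟩ i
    choose g hg hinj using fun i => h (F i) ⟨i, rfl⟩
    obtain ⟨k, ⟨-, hk⟩, -⟩ := hC.2.2 B hB g hg
    intro x y hxy
    apply hinj i
    rw [← hk, ← hk, hxy]
  · intro h
    refine ⟨C, hC.1, ?_⟩
    rintro _ ⟨i, rfl⟩
    exact ⟨c i, hC.2.1 i, h i⟩

/-- A class `X` of algebras is absolutely directed under embeddability: every set of members
of `X` (in particular the empty set) is majorized by some member of `X`. -/
def IsAbsolutelyDirected (X : Set (Alg S)) : Prop :=
  ∀ Y : Set (Alg S), Y ⊆ X → Small.{u} Y → ∃ B ∈ X, ∀ A ∈ Y, Embeds A B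

/-- Every set of nontrivial algebras in `P` is `P`-compatible. -/
def SetsCompatible (P : Set (Alg S)) : Prop :=
  ∀ X : Set (Alg S), Small.{u} X → X ⊆ P → (∀ A ∈ X, ¬ IsTrivial A) → IsCompatible P X

/-- Every pair of nontrivial algebras in `P` is `P`-compatible. -/
def PairsCompatible (P : Set (Alg S)) : Prop :=
  ∀ A ∈ P, ∀ B ∈ P, ¬ IsTrivial A → ¬ IsTrivial B → IsCompatible P {A, B}

end UnivAlg

/-!
The proof rests on two descriptions of generated classes.

A member of the prevariety generated by `X` is separated by homomorphisms into members of `X`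
(`separatedBy`).  When `X` is absolutely directed, all the targets needed for a set of algebras
embed in one `B ∈ X`, and a single power of `B` then receives all nontrivial algebras of that set:
nontriviality guarantees that a nonempty member has at least one homomorphism to `B`, with which
the coordinates belonging to the other members can be filled.  Conversely the nontrivial members
of `P` themselves form an absolutely directed generating class.

For a quasivariety the engine is a compactness principle, `exists_embeds_of_finite`: a family of
algebras embeds in one member of `P` as soon as every finite set of conditions "this operation is
respected" and "these two elements stay distinct" can be satisfied in some member of `P`.  It is
proved by a reduced product over the directed set of finite sets of conditions, finite Horn
sentences being preserved by reduced products along an arbitrary filter.  This yields the passage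
from pairs to sets, because finite sets follow from pairs by induction.  It also shows that the
quasivariety generated by one algebra `B` satisfies the compatibility condition: a finite set of
operation equations in `A` together with one inequality refutes a finite Horn sentence, which
must then fail in `B` too, and a failure in `B` is a map from `A` to `B` meeting these conditions
(`exists_map_of_holds`).  Finally, since the finite Horn sentences form a set, an
absolutely directed class has a member refuting every finite Horn sentence that the class refutes,
and that member alone generates the same quasivariety.
-/

namespace UnivAlg

variable {S : Signature.{u}}

/-! ### Embeddings, products and prevarieties -/

theorem Embeds.refl (A : Alg S) : Embeds A A :=
  ⟨id, fun _ _ => rfl, Function.injective_id⟩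

theorem Embeds.trans {A B C : Alg S} (h : Embeds A B) (k : Embeds B C) : Embeds A C := by
  obtain ⟨f, hf, hfi⟩ := h
  obtain ⟨g, hg, hgi⟩ := k
  exact ⟨g ∘ f, fun o a => by simp [hf o a, hg o], hgi.comp hfi⟩

theorem embeds_of_isEmpty {A : Alg S} (hA : IsEmpty A.carrier) (B : Alg S) : Embeds A B :=
  ⟨fun x => hA.elim x, fun o a => hA.elim (A.op o a), fun x => hA.elim x⟩

theorem not_isTrivial_of_ne {A : Alg S} {x y : A.carrier} (h : x ≠ y) : ¬ IsTrivial A := by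
  rintro ⟨z, hz⟩
  exact h ((hz x).trans (hz y).symm)

theorem exists_ne_of_not_isTrivial {A : Alg S} (hA : ¬ IsTrivial A) (a : A.carrier) :
    ∃ x y : A.carrier, x ≠ y := by
  by_contra! h
  exact hA ⟨a, fun y => h y a⟩

theorem IsPrevariety.mem_of_embeds {P : Set (Alg S)} (hP : IsPrevariety P) {A B : Alg S}
    (hB : B ∈ P) (h : Embeds A B) : A ∈ P :=
  hP.1 ⟨B, hB, h⟩

theorem IsPrevariety.prod_mem {P : Set (Alg S)} (hP : IsPrevariety P) {ι : Type u}
    {F : ι → Alg S} (hF : ∀ i, F i ∈ P) : prod F ∈ P :=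
  hP.2 ⟨ι, F, hF, id, fun _ _ => rfl, Function.bijective_id⟩

/-- A trivial algebra is isomorphic to the product of the empty family. -/
theorem IsPrevariety.mem_of_isTrivial {P : Set (Alg S)} (hP : IsPrevariety P) {A : Alg S}
    (hA : IsTrivial A) : A ∈ P := by
  obtain ⟨a, ha⟩ := hA
  refine hP.2 ⟨PEmpty, fun i => i.elim, fun i => i.elim, fun _ i => i.elim,
    fun _ _ => funext fun i => i.elim, fun x y _ => (ha x).trans (ha y).symm,
    fun _ => ⟨a, funext fun i => i.elim⟩⟩

/-! ### Separation by homomorphisms -/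

/-- The algebras whose distinct elements are separated by homomorphisms into members of `X`. -/
def separatedBy (X : Set (Alg S)) : Set (Alg S) :=
  {A | ∀ x y : A.carrier, x ≠ y → ∃ C ∈ X, ∃ f, IsHom A C f ∧ f x ≠ f y}

theorem subset_separatedBy (X : Set (Alg S)) : X ⊆ separatedBy X :=
  fun A hA _ _ h => ⟨A, hA, id, fun _ _ => rfl, h⟩

theorem isPrevariety_separatedBy (X : Set (Alg S)) : IsPrevariety (separatedBy X) := by
  constructor
  · rintro A ⟨B, hB, f, hf, hfi⟩ x y hxy
    obtain ⟨C, hC, g, hg, hgn⟩ := hB (f x) (f y) (hfi.ne hxy)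
    exact ⟨C, hC, g ∘ f, fun o a => by simp [hf o a, hg o], hgn⟩
  · rintro A ⟨ι, F, hF, f, hf, hfb⟩ x y hxy
    obtain ⟨i, hi⟩ := Function.ne_iff.1 (hfb.1.ne hxy)
    obtain ⟨C, hC, g, hg, hgn⟩ := hF i _ _ hi
    exact ⟨C, hC, fun a => g (f a i), fun o a => by simp [hf o a, hg o, prod], hgn⟩

theorem exists_generating_of_setsCompatible {P : Set (Alg S)} (hP : IsPrevariety P)
    (h : SetsCompatible P) :
    ∃ X : Set (Alg S), IsAbsolutelyDirected X ∧ IsPrevarietyGeneratedBy P X := by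
  by_cases hN : ∃ N ∈ P, ¬ IsTrivial N
  · obtain ⟨N, hNP, hN⟩ := hN
    refine ⟨{A | A ∈ P ∧ ¬ IsTrivial A}, fun Y hY hYs => ?_, ⟨hP, fun A hA => hA.1⟩, ?_⟩
    · -- Adjoining `N` makes an upper bound in `P` nontrivial, unless `N` and all of `Y` are empty.
      obtain ⟨B, hB, hYB⟩ := h (insert N Y) inferInstance
        (Set.insert_subset hNP fun A hA => (hY hA).1)
        (Set.forall_mem_insert.2 ⟨hN, fun A hA => (hY hA).2⟩)
      by_cases hBt : IsTrivial B
      · refine ⟨N, ⟨hNP, hN⟩, fun A hA => ?_⟩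
        refine embeds_of_isEmpty ⟨fun a => ?_⟩ N
        obtain ⟨x, y, hxy⟩ := exists_ne_of_not_isTrivial (hY hA).2 a
        obtain ⟨f, -, hf⟩ := hYB A (Set.mem_insert_of_mem _ hA)
        exact not_isTrivial_of_ne (hf.ne hxy) hBt
      · exact ⟨B, ⟨hB, hBt⟩, fun A hA => hYB A (Set.mem_insert_of_mem _ hA)⟩
    · rintro Q ⟨hQ, hXQ⟩ A hA
      by_cases hAt : IsTrivial A
      · exact hQ.mem_of_isTrivial hAt
      · exact hXQ ⟨hA, hAt⟩
  · push Not at hN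
    refine ⟨P, fun Y hY _ => ?_, ⟨hP, subset_rfl⟩, fun Q hQ => hQ.2⟩
    refine ⟨prod (PEmpty.elim : PEmpty → Alg S), hP.prod_mem fun i => i.elim, fun A hA => ?_⟩
    obtain ⟨a, ha⟩ := hN A (hY hA)
    exact ⟨fun _ i => i.elim, fun _ _ => funext fun i => i.elim,
      fun x y _ => (ha x).trans (ha y).symm⟩

theorem setsCompatible_of_isPrevarietyGeneratedBy {P X : Set (Alg S)} (hP : IsPrevariety P)
    (hX : IsAbsolutelyDirected X) (hPX : IsPrevarietyGeneratedBy P X) : SetsCompatible P := by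
  classical
  intro Y hYs hYP hY
  have hsep : P ⊆ separatedBy X := hPX.2 ⟨isPrevariety_separatedBy X, subset_separatedBy X⟩
  let G : Shrink.{u} Y → Alg S := fun i => ((equivShrink Y).symm i).1
  have hGP : ∀ i, G i ∈ P := fun i => hYP ((equivShrink Y).symm i).2
  let J := Σ i, {p : (G i).carrier × (G i).carrier // p.1 ≠ p.2}
  choose C hCX f hf hfne using fun j : J => hsep (hGP j.1) j.2.1.1 j.2.1.2 j.2.2
  obtain ⟨B, hBX, hB⟩ := hX (Set.range C) (Set.range_subset_iff.2 hCX) inferInstance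
  choose e he hei using fun j => hB (C j) ⟨j, rfl⟩
  refine ⟨prod fun _ : J => B, hP.prod_mem fun _ => hPX.1.2 hBX, fun A hA => ?_⟩
  rcases isEmpty_or_nonempty A.carrier with hE | ⟨⟨a⟩⟩
  · exact embeds_of_isEmpty hE _
  obtain ⟨i, rfl⟩ : ∃ i, G i = A := ⟨equivShrink Y ⟨A, hA⟩, by simp [G]⟩
  obtain ⟨x₀, y₀, h₀⟩ := exists_ne_of_not_isTrivial (hY _ hA) a
  -- The coordinates of the other algebras are filled with the homomorphism separating `x₀`, `y₀`.
  have key : ∀ j : J, ∃ g, IsHom (G i) B g ∧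
      ∀ p, j = ⟨i, p⟩ → g p.1.1 ≠ g p.1.2 := by
    have hom : ∀ p : {p : (G i).carrier × (G i).carrier // p.1 ≠ p.2},
        ∃ g, IsHom (G i) B g ∧ g p.1.1 ≠ g p.1.2 := fun p =>
      ⟨e ⟨i, p⟩ ∘ f ⟨i, p⟩, fun o a => by simp [hf ⟨i, p⟩ o a, he ⟨i, p⟩ o],
        (hei ⟨i, p⟩).ne (hfne ⟨i, p⟩)⟩
    intro j
    by_cases hj : ∃ p, j = ⟨i, p⟩
    · obtain ⟨p, rfl⟩ := hj
      obtain ⟨g, hg, hgn⟩ := hom p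
      refine ⟨g, hg, fun q hq => ?_⟩
      obtain rfl : p = q := eq_of_heq (Sigma.mk.inj hq).2
      exact hgn
    · obtain ⟨g, hg, -⟩ := hom ⟨(x₀, y₀), h₀⟩
      exact ⟨g, hg, fun p hp => (hj ⟨p, hp⟩).elim⟩
  choose g hg hgne using key
  refine ⟨fun a j => g j a, fun o a => funext fun j => hg j o a, fun x y hxy => ?_⟩
  by_contra hne
  exact hgne ⟨i, (x, y), hne⟩ _ rfl (congrFun hxy _)

/-! ### Preservation of finite Horn sentences -/

theorem IsHom.map_eval {A B : Alg S} {f : A.carrier → B.carrier} (hf : IsHom A B f) {V : Type}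
    (x : V → A.carrier) (t : Term S V) : f (t.eval A x) = t.eval B (f ∘ x) := by
  induction t with
  | var v => rfl
  | app o t ih => simp only [Term.eval, hf o, ih]

theorem eval_prod {ι : Type u} (F : ι → Alg S) {V : Type} (x : V → (prod F).carrier)
    (t : Term S V) (i : ι) : t.eval (prod F) x i = t.eval (F i) fun v => x v i := by
  induction t with
  | var v => rfl
  | app o t ih => simp only [Term.eval, prod, ← ih]

theorem QuasiIdentity.Holds.of_embeds {q : QuasiIdentity S} {A B : Alg S} (hB : q.Holds B)
    (h : Embeds A B) : q.Holds A := by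
  obtain ⟨f, hf, hfi⟩ := h
  intro x hx
  apply hfi
  rw [hf.map_eval, hf.map_eval]
  refine hB _ fun e he => ?_
  rw [← hf.map_eval, ← hf.map_eval, hx e he]

theorem QuasiIdentity.Holds.prod {q : QuasiIdentity S} {ι : Type u} {F : ι → Alg S}
    (hF : ∀ i, q.Holds (F i)) : q.Holds (prod F) := by
  intro x hx
  funext i
  rw [eval_prod, eval_prod]
  refine hF i _ fun e he => ?_
  rw [← eval_prod, ← eval_prod, hx e he]

theorem isQuasivariety_setOf_holds (hS : ∀ o : S.Op, Finite (S.arity o))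
    (Φ : Set (QuasiIdentity S)) : IsQuasivariety {A : Alg S | ∀ q ∈ Φ, q.Holds A} where
  finitary := hS
  prevariety := by
    constructor
    · rintro A ⟨B, hB, h⟩ q hq
      exact (hB q hq).of_embeds h
    · rintro A ⟨ι, F, hF, f, hf, hfb⟩ q hq
      exact (QuasiIdentity.Holds.prod fun i => hF i q hq).of_embeds ⟨f, hf, hfb.1⟩
  definable := ⟨Φ, rfl⟩

/-! ### Reduced products -/

/-- Equality of tuples along the filter `l`. -/
def eventuallyEqSetoid {ι : Type u} (l : Filter ι) (F : ι → Alg S) :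
    Setoid ((i : ι) → (F i).carrier) where
  r x y := ∀ᶠ i in l, x i = y i
  iseqv := ⟨fun _ => .of_forall fun _ => rfl, fun h => h.mono fun _ => Eq.symm,
    fun h k => (h.and k).mono fun _ hi => hi.1.trans hi.2⟩

/-- The reduced product of a family of algebras along a filter.  The operations are computed on
chosen representatives; for finite arities the result does not depend on the choice, see
`reducedProd_op_mk`. -/
noncomputable def reducedProd {ι : Type u} (l : Filter ι) (F : ι → Alg S) : Alg S where
  carrier := Quotient (eventuallyEqSetoid l F)
  op o a := Quotient.mk _ fun i => (F i).op o fun k => (a k).out i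

section ReducedProduct

variable {ι : Type u} {l : Filter ι} {F : ι → Alg S}

/-- The class of a tuple in the reduced product. -/
def reducedProd.mk (l : Filter ι) (F : ι → Alg S) (x : (i : ι) → (F i).carrier) :
    (reducedProd l F).carrier :=
  Quotient.mk (eventuallyEqSetoid l F) x

theorem reducedProd.mk_eq_mk {x y : (i : ι) → (F i).carrier} :
    mk l F x = mk l F y ↔ ∀ᶠ i in l, x i = y i :=
  Quotient.eq (r := eventuallyEqSetoid l F)

theorem reducedProd.exists_rep (x : (reducedProd l F).carrier) : ∃ y, mk l F y = x :=
  Quotient.exists_rep x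

theorem reducedProd_op_mk (o : S.Op) [Finite (S.arity o)]
    (a : S.arity o → (i : ι) → (F i).carrier) :
    (reducedProd l F).op o (fun k => reducedProd.mk l F (a k)) =
      reducedProd.mk l F fun i => (F i).op o fun k => a k i := by
  refine reducedProd.mk_eq_mk.2 ?_
  have h : ∀ k, ∀ᶠ i in l, (reducedProd.mk l F (a k)).out i = a k i :=
    fun k => reducedProd.mk_eq_mk.1 (Quotient.out_eq _)
  filter_upwards [Filter.eventually_all.2 h] with i hi
  simp only [hi]

theorem eval_reducedProd (hS : ∀ o : S.Op, Finite (S.arity o)) {V : Type}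
    (x : V → (i : ι) → (F i).carrier) (t : Term S V) :
    t.eval (reducedProd l F) (fun v => reducedProd.mk l F (x v)) =
      reducedProd.mk l F fun i => t.eval (F i) fun v => x v i := by
  induction t with
  | var v => rfl
  | app o t ih =>
    have := hS o
    simp only [Term.eval, ih, reducedProd_op_mk]

theorem IsQuasivariety.reducedProd_mem {P : Set (Alg S)} (hP : IsQuasivariety P)
    (hF : ∀ i, F i ∈ P) : reducedProd l F ∈ P := by
  obtain ⟨Φ, rfl⟩ := hP.definable
  intro q hq x hx
  choose y hy using fun v => reducedProd.exists_rep (x v)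
  obtain rfl : (fun v => reducedProd.mk l F (y v)) = x := funext hy
  simp only [eval_reducedProd hP.finitary, reducedProd.mk_eq_mk] at hx ⊢
  have hx' : ∀ᶠ i in l, ∀ e ∈ q.premises,
      e.1.eval (F i) (fun v => y v i) = e.2.eval (F i) fun v => y v i :=
    (Filter.eventually_all_finite (l := l) (List.finite_toSet q.premises)).2 hx
  filter_upwards [hx'] with i hi
  exact hF i q hq _ hi

end ReducedProduct

/-! ### Compactness for embeddings into a quasivariety -/

/-- The type of elementary conditions on a map out of `A` that together say that it is an embedding:
respecting an operation at one tuple, or keeping a pair of elements distinct. -/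
abbrev Condition (A : Alg S) : Type u :=
  (Σ o : S.Op, S.arity o → A.carrier) ⊕ {p : A.carrier × A.carrier // p.1 ≠ p.2}

/-- The map `f` satisfies an elementary condition. -/
def Condition.Sat {A : Alg S} (B : Alg S) (f : A.carrier → B.carrier) : Condition A → Prop
  | .inl a => f (A.op a.1 a.2) = B.op a.1 fun k => f (a.2 k)
  | .inr p => f p.1.1 ≠ f p.1.2

theorem sat_of_isHom_of_injective {A B : Alg S} {f : A.carrier → B.carrier} (hf : IsHom A B f)
    (hfi : Function.Injective f) (c : Condition A) : c.Sat B f := by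
  rcases c with a | p
  · exact hf a.1 a.2
  · exact hfi.ne p.2

theorem IsQuasivariety.exists_embeds_of_finite {P : Set (Alg S)} (hP : IsQuasivariety P)
    {ι : Type u} (A : ι → Alg S)
    (h : ∀ T : Finset (Σ i, Condition (A i)), ∃ B ∈ P,
      ∃ f : (i : ι) → (A i).carrier → B.carrier, ∀ c ∈ T, c.2.Sat B (f c.1)) :
    ∃ B ∈ P, ∀ i, Embeds (A i) B := by
  choose B hB f hf using h
  have hev : ∀ c : Σ i, Condition (A i), ∀ᶠ T in Filter.atTop, c.2.Sat (B T) (f T c.1) := fun c =>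
    (Filter.eventually_ge_atTop {c}).mono fun T hT => hf T c (Finset.singleton_subset_iff.1 hT)
  refine ⟨reducedProd Filter.atTop B, hP.reducedProd_mem hB, fun i =>
    ⟨fun a => reducedProd.mk _ _ fun T => f T i a, fun o a => ?_, fun x y hxy => ?_⟩⟩
  · have := hP.finitary o
    rw [reducedProd_op_mk, reducedProd.mk_eq_mk]
    exact hev ⟨i, .inl ⟨o, a⟩⟩
  · by_contra hne
    obtain ⟨T, h₁, h₂⟩ :=
      ((reducedProd.mk_eq_mk.1 hxy).and (hev ⟨i, .inr ⟨(x, y), hne⟩⟩)).exists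
    exact h₂ h₁

theorem IsQuasivariety.setsCompatible_of_pairsCompatible {P : Set (Alg S)}
    (hP : IsQuasivariety P) (h : PairsCompatible P) : SetsCompatible P := by
  classical
  intro Y hYs hYP hY
  by_cases hE : ∀ A ∈ Y, IsEmpty A.carrier
  · exact ⟨prod (PEmpty.elim : PEmpty → Alg S), hP.prevariety.prod_mem fun i => i.elim,
      fun A hA => embeds_of_isEmpty (hE A hA) _⟩
  push Not at hE
  obtain ⟨A₀, hA₀, ⟨a₀⟩⟩ := hE
  obtain ⟨x₀, y₀, h₀⟩ := exists_ne_of_not_isTrivial (hY A₀ hA₀) a₀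
  let G : Shrink.{u} Y → Alg S := fun i => ((equivShrink Y).symm i).1
  have hG : ∀ i, G i ∈ Y := fun i => ((equivShrink Y).symm i).2
  -- Embedding `A₀` as well keeps the upper bounds nontrivial along the induction.
  have hfin : ∀ s : Finset (Shrink.{u} Y), ∃ B ∈ P, Embeds A₀ B ∧ ∀ i ∈ s, Embeds (G i) B := by
    intro s
    induction s using Finset.induction_on with
    | empty => exact ⟨A₀, hYP hA₀, .refl _, by simp⟩
    | insert i s _ ih =>
      obtain ⟨B, hB, h0B, hsB⟩ := ih
      have hBt : ¬ IsTrivial B := by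
        obtain ⟨f, -, hf⟩ := h0B
        exact not_isTrivial_of_ne (hf.ne h₀)
      obtain ⟨C, hC, hBC⟩ := h B hB (G i) (hYP (hG i)) hBt (hY _ (hG i))
      have hBC' : Embeds B C := hBC B (by simp)
      refine ⟨C, hC, h0B.trans hBC', Finset.forall_mem_insert _ _ _ |>.2 ⟨hBC _ (by simp), ?_⟩⟩
      exact fun j hj => (hsB j hj).trans hBC'
  obtain ⟨B, hB, hGB⟩ := hP.exists_embeds_of_finite G fun T => by
    obtain ⟨B, hB, ⟨f₀, -, -⟩, hT⟩ := hfin (T.image Sigma.fst)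
    have key : ∀ i, ∃ f : (G i).carrier → B.carrier,
        i ∈ T.image Sigma.fst → ∀ c : Condition (G i), c.Sat B f := by
      intro i
      by_cases hi : i ∈ T.image Sigma.fst
      · obtain ⟨f, hf, hfi⟩ := hT i hi
        exact ⟨f, fun _ => sat_of_isHom_of_injective hf hfi⟩
      · exact ⟨fun _ => f₀ a₀, fun h => (hi h).elim⟩
    choose f hf using key
    exact ⟨B, hB, f, fun c hc => hf c.1 (Finset.mem_image_of_mem _ hc) c.2⟩
  refine ⟨B, hB, fun A hA => ?_⟩
  simpa [G] using hGB (equivShrink Y ⟨A, hA⟩)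

/-! ### Quasivarieties generated by one algebra -/

/-- If `A` satisfies the finite Horn sentences of `B`, then a finite part of the operation tables
of `A` can be realized in `B` with two given elements kept apart: otherwise the sentence whose
premises are these table entries, and whose conclusion identifies the two elements, would hold in
`B` but not in `A`. -/
theorem exists_map_of_holds (hS : ∀ o : S.Op, Finite (S.arity o)) {A B : Alg S}
    (hAB : ∀ q : QuasiIdentity S, q.Holds B → q.Holds A)
    (T : Finset (Σ o : S.Op, S.arity o → A.carrier)) {x y : A.carrier} (hxy : x ≠ y) :
    ∃ f : A.carrier → B.carrier,
      (∀ a ∈ T, f (A.op a.1 a.2) = B.op a.1 fun k => f (a.2 k)) ∧ f x ≠ f y := by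
  classical
  -- The finitely many elements that occur become the variables.
  let E : Set A.carrier :=
    {x, y} ∪ ⋃ a ∈ T, insert (A.op a.1 a.2) (Set.range a.2)
  have hE : E.Finite := by
    refine (Set.toFinite _).union (T.finite_toSet.biUnion fun a _ => ?_)
    have := hS a.1
    exact (Set.finite_range _).insert _
  have hxE : x ∈ E := by simp [E]
  have hyE : y ∈ E := by simp [E]
  have hopE : ∀ a ∈ T, A.op a.1 a.2 ∈ E := fun a ha =>
    Or.inr (Set.mem_biUnion ha (Set.mem_insert _ _))
  have hargE : ∀ a ∈ T, ∀ k, a.2 k ∈ E := fun a ha k =>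
    Or.inr (Set.mem_biUnion ha (Set.mem_insert_of_mem _ ⟨k, rfl⟩))
  have : Finite E := hE
  obtain ⟨n, ⟨e⟩⟩ := Finite.exists_equiv_fin E
  -- Elements outside `E` do not occur; they are sent to the variable of `x`.
  let v : A.carrier → Fin n := fun a => if h : a ∈ E then e ⟨a, h⟩ else e ⟨x, hxE⟩
  have hv : ∀ a ∈ E, ((e.symm (v a) : E) : A.carrier) = a := fun a ha => by simp [v, ha]
  let q : QuasiIdentity S :=
    { numVars := n
      premises := T.toList.map fun a =>
        (.app a.1 fun k => .var (v (a.2 k)), .var (v (A.op a.1 a.2)))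
      conclusion := (.var (v x), .var (v y)) }
  have hq : ¬ q.Holds A := by
    intro hq
    have := hq (fun i => (e.symm i : E)) ?_
    · exact hxy (by simpa only [q, Term.eval, hv x hxE, hv y hyE] using this)
    · intro p hp
      obtain ⟨a, ha, rfl⟩ := List.mem_map.1 hp
      rw [Finset.mem_toList] at ha
      simp only [Term.eval, hv _ (hopE a ha), hv _ (hargE a ha _)]
  have hqB : ¬ q.Holds B := fun h => hq (hAB q h)
  unfold QuasiIdentity.Holds at hqB
  push Not at hqB
  obtain ⟨t, ht, hne⟩ := hqB
  refine ⟨t ∘ v, fun a ha => ?_, hne⟩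
  exact (ht _ (List.mem_map.2 ⟨a, Finset.mem_toList.2 ha, rfl⟩)).symm

theorem IsQuasivariety.setsCompatible_of_generatedBy_singleton {P : Set (Alg S)}
    (hP : IsQuasivariety P) {B : Alg S} (hB : IsQuasivarietyGeneratedBy P {B}) :
    SetsCompatible P := by
  classical
  intro Y hYs hYP hY
  have hmem : B ∈ P := hB.1.2 rfl
  have hholds : ∀ A ∈ P, ∀ q : QuasiIdentity S, q.Holds B → q.Holds A := fun A hA q hq =>
    hB.2 ⟨isQuasivariety_setOf_holds hP.finitary {q | q.Holds B},
      Set.singleton_subset_iff.2 fun _ h => h⟩ hA q hq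
  let G : Shrink.{u} Y → Alg S := fun i => ((equivShrink Y).symm i).1
  have hG : ∀ i, G i ∈ Y := fun i => ((equivShrink Y).symm i).2
  obtain ⟨C, hC, hGC⟩ := hP.exists_embeds_of_finite G fun T => by
    let J := Σ i, {p : (G i).carrier × (G i).carrier // p.1 ≠ p.2}
    let R : ∀ i, Finset (Σ o : S.Op, S.arity o → (G i).carrier) := fun i =>
      T.preimage (fun a => ⟨i, .inl a⟩) fun a _ b _ hab => by simpa using hab
    have hsep : ∀ i, ∀ p : {p : (G i).carrier × (G i).carrier // p.1 ≠ p.2},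
        ∃ f : (G i).carrier → B.carrier,
          (∀ a ∈ R i, f ((G i).op a.1 a.2) = B.op a.1 fun k => f (a.2 k)) ∧ f p.1.1 ≠ f p.1.2 :=
      fun i p => exists_map_of_holds hP.finitary (hholds _ (hYP (hG i))) (R i) p.2
    -- In the power `B ^ J`, the coordinate `⟨i, p⟩` separates the pair `p` of elements of `G i`.
    have key : ∀ i, ∀ j : J, ∃ f : (G i).carrier → B.carrier,
        (∀ a ∈ R i, f ((G i).op a.1 a.2) = B.op a.1 fun k => f (a.2 k)) ∧
          ∀ p, j = ⟨i, p⟩ → f p.1.1 ≠ f p.1.2 := by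
      intro i j
      by_cases hj : ∃ p, j = ⟨i, p⟩
      · obtain ⟨p, rfl⟩ := hj
        obtain ⟨f, hf, hfn⟩ := hsep i p
        refine ⟨f, hf, fun r hr => ?_⟩
        obtain rfl : p = r := eq_of_heq (Sigma.mk.inj hr).2
        exact hfn
      · rcases isEmpty_or_nonempty (G i).carrier with hE | ⟨⟨a⟩⟩
        · exact ⟨fun a => hE.elim a, fun a _ => hE.elim ((G i).op a.1 a.2),
            fun p => hE.elim p.1.1⟩
        · obtain ⟨x, y, hxy⟩ := exists_ne_of_not_isTrivial (hY _ (hG i)) a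
          obtain ⟨f, hf, -⟩ := hsep i ⟨(x, y), hxy⟩
          exact ⟨f, hf, fun p hp => (hj ⟨p, hp⟩).elim⟩
    choose f hf hfne using key
    refine ⟨prod fun _ : J => B, hP.prevariety.prod_mem fun _ => hmem,
      fun i a j => f i j a, ?_⟩
    rintro ⟨i, a | p⟩ hc
    · exact funext fun j => hf i j a (Finset.mem_preimage.2 hc)
    · exact fun hp => hfne i ⟨i, p⟩ p rfl (congrFun hp ⟨i, p⟩)
  refine ⟨C, hC, fun A hA => ?_⟩
  simpa [G] using hGC (equivShrink Y ⟨A, hA⟩)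

/-- A member of `X` into which a counterexample to each finite Horn sentence failing in `X` embeds
generates the same quasivariety as `X`. -/
theorem exists_generatedBy_singleton {P X : Set (Alg S)} (hX : IsAbsolutelyDirected X)
    (hPX : IsQuasivarietyGeneratedBy P X) : ∃ A : Alg S, IsQuasivarietyGeneratedBy P {A} := by
  choose C hCX hC using fun q : {q : QuasiIdentity S // ∃ A, A ∈ X ∧ ¬ q.Holds A} => q.2
  obtain ⟨B, hBX, hB⟩ := hX (Set.range C) (Set.range_subset_iff.2 hCX) inferInstance
  refine ⟨B, ⟨hPX.1.1, Set.singleton_subset_iff.2 (hPX.1.2 hBX)⟩, ?_⟩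
  rintro Q ⟨hQ, hBQ⟩
  refine hPX.2 ⟨hQ, fun A hA => ?_⟩
  obtain ⟨Φ, rfl⟩ := hQ.definable
  intro q hq
  by_contra hqA
  exact hC ⟨q, A, hA, hqA⟩ ((hBQ rfl q hq).of_embeds (hB _ ⟨_, rfl⟩))

theorem IsPrevarietyGeneratedBy.isQuasivarietyGeneratedBy {P X : Set (Alg S)}
    (hP : IsQuasivariety P) (h : IsPrevarietyGeneratedBy P X) : IsQuasivarietyGeneratedBy P X :=
  ⟨⟨hP, h.1.2⟩, fun _ hQ => h.2 ⟨hQ.1.prevariety, hQ.2⟩⟩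

theorem SetsCompatible.pairsCompatible {P : Set (Alg S)} (h : SetsCompatible P) :
    PairsCompatible P := fun A hA B hB hAt hBt =>
  h {A, B} inferInstance (Set.insert_subset hA (Set.singleton_subset_iff.2 hB)) <| by
    rintro _ (rfl | rfl)
    exacts [hAt, hBt]

end UnivAlg

theorem theorem8p2 (S : UnivAlg.Signature.{u}) (P : Set (UnivAlg.Alg S))
    (hP : UnivAlg.IsPrevariety P) :
    (UnivAlg.SetsCompatible P ↔
      ∃ X : Set (UnivAlg.Alg S),
        UnivAlg.IsAbsolutelyDirected X ∧ UnivAlg.IsPrevarietyGeneratedBy P X) ∧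
    (UnivAlg.IsQuasivariety P →
      List.TFAE [
        UnivAlg.SetsCompatible P,
        ∃ X : Set (UnivAlg.Alg S),
          UnivAlg.IsAbsolutelyDirected X ∧ UnivAlg.IsPrevarietyGeneratedBy P X,
        UnivAlg.PairsCompatible P,
        ∃ X : Set (UnivAlg.Alg S),
          UnivAlg.IsAbsolutelyDirected X ∧ UnivAlg.IsQuasivarietyGeneratedBy P X,
        ∃ A : UnivAlg.Alg S, UnivAlg.IsQuasivarietyGeneratedBy P {A}]) := by
  open UnivAlg in
  have h₁₂ : SetsCompatible P ↔
      ∃ X : Set (Alg S), IsAbsolutelyDirected X ∧ IsPrevarietyGeneratedBy P X :=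
    ⟨exists_generating_of_setsCompatible hP,
      fun ⟨_, hX, hPX⟩ => setsCompatible_of_isPrevarietyGeneratedBy hP hX hPX⟩
  refine ⟨h₁₂, fun hQ => ?_⟩
  tfae_have 1 ↔ 2 := h₁₂
  tfae_have 1 → 3 := fun h => h.pairsCompatible
  tfae_have 3 → 1 := hQ.setsCompatible_of_pairsCompatible
  tfae_have 2 → 4 := fun ⟨X, hX, hPX⟩ => ⟨X, hX, hPX.isQuasivarietyGeneratedBy hQ⟩
  tfae_have 4 → 5 := fun ⟨_, hX, hPX⟩ => UnivAlg.exists_generatedBy_singleton hX hPX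
  tfae_have 5 → 1 := fun ⟨_, hA⟩ => hQ.setsCompatible_of_generatedBy_singleton hA
  tfae_finish
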